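/- Let $S^1=\mathbb{R}/\mathbb{Z}$, let $\mathrm{Diff}^{\omega,\delta}_+S^1$ be the group of orientation preserving real analytic diffeomorphisms of $S^1$ with the discrete topology, and let $B\mathrm{Diff}^{\omega,\delta}_+S^1$ be its classifying space, whose homology and cohomology are the group homology and cohomology of $\mathrm{Diff}^{\omega,\delta}_+S^1$ with trivial coefficients. Let $\chi\in H^2(B\mathrm{Diff}^{\omega,\delta}_+S^1;\mathbb{Z})$ be the Euler class, i.e. the class of the central extension $$0\to\mathbb{Z}\to\widetilde{\mathrm{Diff}}{}^{\omega}_+S^1\to\mathrm{Diff}^{\omega}_+S^1\to 1$$ in which $\widetilde{\mathrm{Diff}}{}^{\omega}_+S^1$ is the group of all lifts $F:\mathbb{R}\to\mathbb{R}$, $F(x+1)=F(x)+1$, of elements of $\mathrm{Diff}^{\omega}_+S^1$, and $m\in\mathbb{Z}$ acts by $x\mapsto x+m$. Denote the image of $\chi$ in $H^2(B\mathrm{Diff}^{\omega,\delta}_+S^1;\mathbb{Q})$ also by $\chi$, and let $\chi^k$ be its $k$-th cup power. Let $n\ge 2$ and $k\ge 1$ be integers, and let $\mathbb{Z}/n\mathbb{Z}\subset\mathrm{Diff}^{\omega,\delta}_+S^1$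 be the subgroup generated by the rotation $x\mapsto x+1/n$ of $S^1$. Assume that the homomorphism $$H_{2k-1}(\mathbb{Z}/n\mathbb{Z};\mathbb{Z})\to H_{2k-1}(B\mathrm{Diff}^{\omega,\delta}_+S^1;\mathbb{Z})$$ induced by the inclusion is zero. Then $$\chi^k\neq 0\in H^{2k}(B\mathrm{Diff}^{\omega,\delta}_+S^1;\mathbb{Q}).$$ -/

import Mathlib

open scoped Manifold ContDiff
open CategoryTheory

noncomputable section

/-- The covering `ℝ → S¹`, `x ↦ exp (2πix)`, identifying `S¹` with `ℝ/ℤ`. -/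
def circleCover (x : ℝ) : Circle := Circle.exp (2 * Real.pi * x)

theorem circleCover_eq_iff {x y : ℝ} :
    circleCover x = circleCover y ↔ ∃ m : ℤ, x = y + m := by
  have hp : (2 * Real.pi) ≠ 0 := by positivity
  rw [circleCover, circleCover, Circle.exp_eq_exp]
  refine exists_congr fun m => ?_
  rw [show 2 * Real.pi * y + m * (2 * Real.pi) = 2 * Real.pi * (y + m) by ring,
    mul_right_inj' hp]

theorem circleCover_surjective : Function.Surjective circleCover := fun z => by
  obtain ⟨t, rfl⟩ := Circle.exp_surjective z
  exact ⟨t / (2 * Real.pi), by rw [circleCover, mul_div_cancel₀ _ (by positivity)]⟩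

theorem circleCover_add (x y : ℝ) : circleCover (x + y) = circleCover x * circleCover y := by
  simp only [circleCover, mul_add, Circle.exp_add]

theorem continuous_circleCover : Continuous circleCover :=
  Circle.exp.continuous.comp (continuous_const.mul continuous_id)

/-- A homeomorphism of `S¹` preserves the orientation if it lifts to an increasing map of `ℝ`. -/
def PreservesOrientation (f : Circle ≃ₜ Circle) : Prop :=
  ∃ F : ℝ → ℝ, Continuous F ∧ StrictMono F ∧ ∀ x, circleCover (F x) = f (circleCover x)

/-- A continuous function whose values are integers is constant. -/
theorem exists_int_eq_of_continuous {h : ℝ → ℝ} (hc : Continuous h)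
    (hz : ∀ x, ∃ m : ℤ, h x = m) : ∃ m : ℤ, ∀ x, h x = m := by
  obtain ⟨m, hm⟩ := hz 0
  refine ⟨m, fun x => ?_⟩
  choose c hcc using hz
  have hc' : Continuous c := by
    refine Int.isClosedEmbedding_coe_real.isInducing.continuous_iff.2 ?_
    exact hc.congr hcc
  rw [← hm, hcc x, hcc 0, PreconnectedSpace.constant inferInstance hc' (x := x) (y := 0)]

theorem PreservesOrientation.exists_lift {f : Circle ≃ₜ Circle} (hf : PreservesOrientation f) :
    ∃ F : CircleDeg1Liftˣ, ∀ x, circleCover (F x) = f (circleCover x) := by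
  obtain ⟨F, hFc, hFm, hF⟩ := hf
  obtain ⟨d, hd⟩ : ∃ d : ℤ, ∀ x, F (x + 1) - F x = d := by
    refine exists_int_eq_of_continuous (by fun_prop) fun x => ?_
    obtain ⟨m, hm⟩ : ∃ m : ℤ, F (x + 1) = F x + m := by
      rw [← circleCover_eq_iff, hF, hF, circleCover_eq_iff.2 (⟨1, by simp⟩ : ∃ m : ℤ, x + 1 = x + m)]
    exact ⟨m, by linarith⟩
  have hd0 : 0 < d := by
    have := hFm (show (0 : ℝ) < 0 + 1 by norm_num)
    have h2 := hd 0
    exact_mod_cast (show (0 : ℝ) < d by linarith)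
  have hd1 : d = 1 := by
    by_contra hne
    have hd2 : (2 : ℝ) ≤ d := by exact_mod_cast (show 2 ≤ d by omega)
    have h0 := hd 0
    rw [zero_add] at h0
    obtain ⟨y, hy, hFy⟩ := intermediate_value_Icc (zero_le_one' ℝ) hFc.continuousOn
      (show F 0 + 1 ∈ Set.Icc (F 0) (F 1) from ⟨by linarith, by linarith⟩)
    have h1 : circleCover y = circleCover 0 := by
      apply f.injective
      rw [← hF, ← hF, circleCover_eq_iff]
      exact ⟨1, by simp [hFy]⟩
    obtain ⟨m, hm⟩ := circleCover_eq_iff.1 h1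
    have hy0 : y ≠ 0 := by rintro rfl; linarith
    have hy1 : y ≠ 1 := by rintro rfl; linarith
    have a1 : (0 : ℝ) < m := by
      have := lt_of_le_of_ne hy.1 (Ne.symm hy0); linarith
    have a2 : (m : ℝ) < 1 := by
      have := lt_of_le_of_ne hy.2 hy1; linarith
    have a3 : 0 < m := by exact_mod_cast a1
    have a4 : m < 1 := by exact_mod_cast a2
    omega
  let L : CircleDeg1Lift := ⟨⟨F, hFm.monotone⟩, fun x => by
    have := hd x
    rw [hd1, Int.cast_one] at this
    change F (x + 1) = F x + 1
    linarith⟩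
  have hL : Function.Bijective L :=
    ⟨hFm.injective, hFc.surjective L.tendsto_atTop L.tendsto_atBot⟩
  obtain ⟨u, hu⟩ := CircleDeg1Lift.isUnit_iff_bijective.2 hL
  exact ⟨u, fun x => by rw [hu]; exact hF x⟩

theorem preservesOrientation_of_lift {f : Circle ≃ₜ Circle} (F : CircleDeg1Liftˣ)
    (hF : ∀ x, circleCover (F x) = f (circleCover x)) : PreservesOrientation f :=
  ⟨F, (CircleDeg1Lift.toOrderIso F).continuous, (CircleDeg1Lift.toOrderIso F).strictMono, hF⟩

theorem lift_mul {f g : Circle ≃ₜ Circle} {F G : CircleDeg1Liftˣ}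
    (hF : ∀ x, circleCover (F x) = f (circleCover x))
    (hG : ∀ x, circleCover (G x) = g (circleCover x)) (x : ℝ) :
    circleCover ((F * G : CircleDeg1Liftˣ) x) = (f * g) (circleCover x) := by
  change circleCover (F (G x)) = f (g (circleCover x))
  rw [hF, hG]

theorem lift_inv {f : Circle ≃ₜ Circle} {F : CircleDeg1Liftˣ}
    (hF : ∀ x, circleCover (F x) = f (circleCover x)) (x : ℝ) :
    circleCover ((F⁻¹ : CircleDeg1Liftˣ) x) = f⁻¹ (circleCover x) := by
  apply f.injective
  rw [← hF, CircleDeg1Lift.units_apply_inv_apply]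
  exact (f.apply_symm_apply _).symm

/-- The group `Diff^ω_+ S¹` of orientation preserving real analytic diffeomorphisms of the circle,
as a discrete group. -/
def AnalyticDiff : Subgroup (Circle ≃ₜ Circle) where
  carrier := {f | ContMDiff (𝓡 1) (𝓡 1) ω f ∧ ContMDiff (𝓡 1) (𝓡 1) ω f.symm ∧
    PreservesOrientation f}
  mul_mem' := by
    rintro f g ⟨hf, hf', hfo⟩ ⟨hg, hg', hgo⟩
    obtain ⟨F, hF⟩ := hfo.exists_lift
    obtain ⟨G, hG⟩ := hgo.exists_lift
    exact ⟨hf.comp hg, hg'.comp hf', preservesOrientation_of_lift (F * G) (lift_mul hF hG)⟩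
  one_mem' := ⟨contMDiff_id, contMDiff_id, preservesOrientation_of_lift 1 fun _ => rfl⟩
  inv_mem' := by
    rintro f ⟨hf, hf', hfo⟩
    obtain ⟨F, hF⟩ := hfo.exists_lift
    exact ⟨hf', hf, preservesOrientation_of_lift F⁻¹ (lift_inv hF)⟩

/-- The rotation of `S¹ = ℝ/ℤ` by `t`, that is `x ↦ x + t`. -/
def circleRotation (t : ℝ) : AnalyticDiff :=
  ⟨Homeomorph.mulLeft (circleCover t), contMDiff_mul_left, by
    rw [Homeomorph.mulLeft_symm]
    exact contMDiff_mul_left,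
    preservesOrientation_of_lift (CircleDeg1Lift.translate (Multiplicative.ofAdd t)) fun x => by
      rw [CircleDeg1Lift.translate_apply, circleCover_add]
      rfl⟩

/-- The universal covering group of `Diff^ω_+ S¹`: pairs `(f, F)` of `f ∈ Diff^ω_+ S¹` and a lift
`F : ℝ → ℝ` of `f` that commutes with `x ↦ x + 1`, under composition. -/
def LiftedAnalyticDiff : Subgroup (AnalyticDiff × CircleDeg1Liftˣ) where
  carrier := {p | ∀ x, circleCover (p.2 x) = (p.1 : Circle ≃ₜ Circle) (circleCover x)}
  mul_mem' := fun hp hq => lift_mul hp hq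
  one_mem' := fun _ => rfl
  inv_mem' := fun hp => lift_inv hp

/-- The central extension `0 → ℤ → G̃ → G → 1` of `G = Diff^ω_+ S¹` by its universal covering group;
`m ∈ ℤ` is sent to the translation by `m`. -/
def universalCoverExtension :
    GroupExtension (Multiplicative ℤ) LiftedAnalyticDiff AnalyticDiff where
  inl :=
    { toFun := fun m => ⟨(1, CircleDeg1Lift.translate (Multiplicative.ofAdd (m.toAdd : ℝ))),
        fun x => by
          change circleCover ((m.toAdd : ℝ) + x) = circleCover x
          exact circleCover_eq_iff.2 ⟨m.toAdd, add_comm _ _⟩⟩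
      map_one' := by
        ext x
        · rfl
        · change ((0 : ℤ) : ℝ) + x = x
          simp
      map_mul' := fun a b => by
        ext x
        · rfl
        · change ((a.toAdd + b.toAdd : ℤ) : ℝ) + x = (a.toAdd : ℝ) + ((b.toAdd : ℝ) + x)
          push_cast
          ring }
  rightHom := (MonoidHom.fst AnalyticDiff CircleDeg1Liftˣ).comp LiftedAnalyticDiff.subtype
  inl_injective := fun a b hab => by
    have h : (a.toAdd : ℝ) + 0 = (b.toAdd : ℝ) + 0 :=
      congrArg (fun p : LiftedAnalyticDiff => p.1.2 (0 : ℝ)) hab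
    exact Multiplicative.toAdd.injective (by simpa using h)
  range_inl_eq_ker_rightHom := by
    ext p
    constructor
    · rintro ⟨m, rfl⟩
      rfl
    · obtain ⟨⟨f, F⟩, hp⟩ := p
      rintro (rfl : f = 1)
      have hp' : ∀ x, circleCover (F x) = circleCover x := hp
      obtain ⟨m, hm⟩ : ∃ m : ℤ, ∀ x, F x - x = m := by
        refine exists_int_eq_of_continuous
          ((CircleDeg1Lift.toOrderIso F).continuous.sub continuous_id) fun x => ?_
        obtain ⟨m, hm⟩ := circleCover_eq_iff.1 (hp' x)
        exact ⟨m, by linarith⟩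
      refine ⟨Multiplicative.ofAdd m, ?_⟩
      ext x
      · rfl
      · change (m : ℝ) + x = F x
        linarith [hm x]
  rightHom_surjective := fun f => by
    obtain ⟨F, hF⟩ := f.2.2.2.exists_lift
    exact ⟨⟨(f, F), hF⟩, rfl⟩

theorem universalCoverExtension_central (m : Multiplicative ℤ) (e : LiftedAnalyticDiff) :
    Commute (universalCoverExtension.inl m) e := by
  obtain ⟨⟨f, F⟩, hp⟩ := e
  ext x
  · rfl
  · change (m.toAdd : ℝ) + F x = F ((m.toAdd : ℝ) + x)
    simp

/-- The cocycle `(g, h) ↦ σ(g) σ(h) σ(gh)⁻¹` of a central extension by `ℤ` with a section `σ`. -/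
def GroupExtension.sectionCocycle {E G : Type} [Group E] [Group G]
    (S : GroupExtension (Multiplicative ℤ) E G) (σ : S.Section) (g : G × G) : ℤ :=
  (Function.invFun S.inl (σ g.1 * σ g.2 * (σ (g.1 * g.2))⁻¹)).toAdd

theorem GroupExtension.inl_sectionCocycle {E G : Type} [Group E] [Group G]
    (S : GroupExtension (Multiplicative ℤ) E G) (σ : S.Section) (g h : G) :
    S.inl (Multiplicative.ofAdd (S.sectionCocycle σ (g, h))) * σ (g * h) = σ g * σ h := by
  have : ∃ m, S.inl m = σ g * σ h * (σ (g * h))⁻¹ := by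
    rw [← MonoidHom.mem_range, S.range_inl_eq_ker_rightHom, MonoidHom.mem_ker]
    simp
  rw [GroupExtension.sectionCocycle, ofAdd_toAdd, Function.invFun_eq this, inv_mul_cancel_right]

theorem GroupExtension.sectionCocycle_mem {E G : Type} [Group E] [Group G]
    (S : GroupExtension (Multiplicative ℤ) E G) (hS : ∀ m e, Commute (S.inl m) e)
    (σ : S.Section) :
    S.sectionCocycle σ ∈ groupCohomology.cocycles₂ (Rep.trivial ℤ G ℤ) := by
  rw [groupCohomology.mem_cocycles₂_iff]
  intro g h j
  apply Multiplicative.ofAdd.injective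
  apply S.inl_injective
  apply mul_right_cancel (b := σ (g * h * j))
  simp only [Representation.trivial_apply, ofAdd_add, map_mul]
  have e1 := S.inl_sectionCocycle σ g h
  have e2 := S.inl_sectionCocycle σ h j
  have e3 := S.inl_sectionCocycle σ (g * h) j
  have e4 := S.inl_sectionCocycle σ g (h * j)
  rw [mul_assoc g h j] at e3 ⊢
  rw [(hS _ _).eq, mul_assoc, e3, ← mul_assoc, e1, mul_assoc, mul_assoc, e4,
    ← e2]
  exact (hS _ _).symm.left_comm _

/-- The class in `H²(G; ℤ)` of a central extension of `G` by `ℤ` with a section `σ`. -/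
def GroupExtension.classOf {E G : Type} [Group E] [Group G]
    (S : GroupExtension (Multiplicative ℤ) E G) (hS : ∀ m e, Commute (S.inl m) e)
    (σ : S.Section) : groupCohomology (Rep.trivial ℤ G ℤ) 2 :=
  groupCohomology.H2π _ ⟨S.sectionCocycle σ, S.sectionCocycle_mem hS σ⟩

theorem GroupExtension.classOf_eq {E G : Type} [Group E] [Group G]
    (S : GroupExtension (Multiplicative ℤ) E G) (hS : ∀ m e, Commute (S.inl m) e)
    (σ τ : S.Section) : S.classOf hS σ = S.classOf hS τ := by
  have hx : ∀ g, ∃ m, S.inl m = σ g * (τ g)⁻¹ := fun g => by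
    rw [← MonoidHom.mem_range, S.range_inl_eq_ker_rightHom, MonoidHom.mem_ker]
    simp
  choose b hb using hx
  have hb' : ∀ g, σ g = S.inl (b g) * τ g := fun g => by rw [hb]; group
  refine (groupCohomology.H2π_eq_iff _ _).2 ⟨fun g => (b g).toAdd, ?_⟩
  funext ⟨g, h⟩
  have e1 := S.inl_sectionCocycle σ g h
  have e2 := S.inl_sectionCocycle τ g h
  have key : b (g * h) * Multiplicative.ofAdd (S.sectionCocycle σ (g, h)) =
      b g * b h * Multiplicative.ofAdd (S.sectionCocycle τ (g, h)) := by
    apply S.inl_injective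
    apply mul_right_cancel (b := τ (g * h))
    simp only [map_mul]
    rw [(hS _ (S.inl _)).eq, mul_assoc, ← hb', e1, hb', hb', mul_assoc (S.inl (b g) * _), e2,
      mul_assoc, mul_assoc, ← mul_assoc (τ g), ← (hS _ (τ g)).eq, mul_assoc]
  have key' := congrArg Multiplicative.toAdd key
  simp only [toAdd_mul, toAdd_ofAdd] at key'
  change (b h).toAdd - (b (g * h)).toAdd + (b g).toAdd =
    S.sectionCocycle σ (g, h) - S.sectionCocycle τ (g, h)
  linarith

section Cup

variable {G R : Type} [CommRing R]

/-- The cup product of cochains,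
`(f ∪ g)(x₁, …, xₚ₊ᵩ) = f(x₁, …, xₚ) g(xₚ₊₁, …, xₚ₊ᵩ)`. -/
def cupCochain {p q n : ℕ} (h : p + q = n) (f : (Fin p → G) → R) (g : (Fin q → G) → R) :
    (Fin n → G) → R := fun x =>
  f (fun i => x ⟨i, by omega⟩) * g (fun j => x ⟨p + j, by omega⟩)

theorem cupCochain_sub_left {p q n : ℕ} (h : p + q = n) (f f' : (Fin p → G) → R)
    (g : (Fin q → G) → R) : cupCochain h (f - f') g = cupCochain h f g - cupCochain h f' g :=
  funext fun _ => sub_mul _ _ _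

theorem cupCochain_sub_right {p q n : ℕ} (h : p + q = n) (f : (Fin p → G) → R)
    (g g' : (Fin q → G) → R) : cupCochain h f (g - g') = cupCochain h f g - cupCochain h f g' :=
  funext fun _ => mul_sub _ _ _

theorem cupCochain_zero_left {p q n : ℕ} (h : p + q = n) (g : (Fin q → G) → R) :
    cupCochain h (0 : (Fin p → G) → R) g = 0 := funext fun _ => zero_mul _

theorem cupCochain_zero_right {p q n : ℕ} (h : p + q = n) (f : (Fin p → G) → R) :
    cupCochain h f (0 : (Fin q → G) → R) = 0 := funext fun _ => mul_zero _

variable {k : Type} [CommRing k] [Group G] [Algebra k R]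

variable (k) in
/-- The differential on cochains with coefficients in the trivial module `R`. -/
abbrev dCochain {n : ℕ} (f : (Fin n → G) → R) : (Fin (n + 1) → G) → R :=
  inhomogeneousCochains.d (Rep.trivial k G R) n f

theorem dCochain_apply {n : ℕ} (f : (Fin n → G) → R) (x : Fin (n + 1) → G) :
    dCochain k f x = f (fun i => x i.succ) +
      ∑ j : Fin (n + 1), (-1) ^ ((j : ℕ) + 1) * f (Fin.contractNth j (· * ·) x) := by
  refine (inhomogeneousCochains.d_hom_apply (Rep.trivial k G R) n f x).trans ?_
  congr 1
  refine Finset.sum_congr rfl fun j _ => ?_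
  rcases neg_one_pow_eq_or k ((j : ℕ) + 1) with hj | hj <;>
  rcases Nat.even_or_odd ((j : ℕ) + 1) with hj' | hj' <;>
  simp [hj'.neg_one_pow]

theorem dCochain_cupCochain {p q n : ℕ} (h : p + q = n) (f : (Fin p → G) → R)
    (g : (Fin q → G) → R) :
    dCochain k (cupCochain h f g) =
      cupCochain (show p + 1 + q = n + 1 by omega) (dCochain k f) g +
        (-1 : R) ^ p • cupCochain (show p + (q + 1) = n + 1 by omega) f (dCochain k g) := by
  subst h
  funext x
  have hF : ∀ {m : ℕ} (F : (Fin m → G) → R) {y z : Fin m → G}, (∀ i, y i = z i) → F y = F z :=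
    fun F y z hyz => congrArg F (funext hyz)
  rw [dCochain_apply, Pi.add_apply, Pi.smul_apply]
  simp only [cupCochain, dCochain_apply, smul_eq_mul]
  have hsum : ∀ φ : Fin (p + q + 1) → R, ∑ j, φ j =
      ∑ i : Fin p, φ ⟨i, by omega⟩ + ∑ j : Fin (q + 1), φ ⟨p + j, by omega⟩ :=
    fun φ => Fin.sum_univ_add (a := p) (b := q + 1) φ
  rw [hsum, Fin.sum_univ_castSucc (n := p)]
  have t1 : ∀ j : Fin p, ∀ i : Fin p,
      Fin.contractNth (n := p + q) ⟨j, by omega⟩ (· * ·) x ⟨i, by omega⟩ =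
        Fin.contractNth j.castSucc (· * ·) (fun i : Fin (p + 1) => x ⟨i, by omega⟩) i := by
    intro j i
    rfl
  have t2 : ∀ j : Fin p, ∀ i : Fin q,
      Fin.contractNth (n := p + q) ⟨j, by omega⟩ (· * ·) x ⟨p + i, by omega⟩ =
        x ⟨p + 1 + i, by omega⟩ := by
    intro j i
    rw [Fin.contractNth_apply_of_gt]
    · exact congrArg x (Fin.ext (by simp; omega))
    · simp; omega
  have t3 : ∀ j : Fin (q + 1), ∀ i : Fin p,
      Fin.contractNth (n := p + q) ⟨p + j, by omega⟩ (· * ·) x ⟨i, by omega⟩ = x ⟨i, by omega⟩ := by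
    intro j i
    rw [Fin.contractNth_apply_of_lt]
    · rfl
    · simp; omega
  have t4 : ∀ j : Fin (q + 1), ∀ i : Fin q,
      Fin.contractNth (n := p + q) ⟨p + j, by omega⟩ (· * ·) x ⟨p + i, by omega⟩ =
        Fin.contractNth j (· * ·) (fun i : Fin (q + 1) => x ⟨p + i, by omega⟩) i := by
    intro j i
    simp only [Fin.contractNth, add_lt_add_iff_left, add_right_inj]
    rfl
  have t5 : ∀ i : Fin p,
      Fin.contractNth (Fin.last p) (· * ·) (fun i : Fin (p + 1) => x ⟨i, by omega⟩) i =
        x ⟨i, by omega⟩ := by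
    intro i
    rw [Fin.contractNth_apply_of_lt]
    · rfl
    · simp
  have s1 : ∀ j : Fin p, (-1 : R) ^ ((j : ℕ) + 1) *
      (f (fun i => Fin.contractNth (n := p + q) ⟨j, by omega⟩ (· * ·) x ⟨i, by omega⟩) *
        g (fun i => Fin.contractNth (n := p + q) ⟨j, by omega⟩ (· * ·) x ⟨p + i, by omega⟩)) =
      (-1 : R) ^ ((j.castSucc : ℕ) + 1) *
      f (Fin.contractNth j.castSucc (· * ·) (fun i : Fin (p + 1) => x ⟨i, by omega⟩)) *
        g (fun i => x ⟨p + 1 + i, by omega⟩) := by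
    intro j
    rw [hF f (t1 j), hF g (t2 j), mul_assoc]
    rfl
  have s2 : ∀ j : Fin (q + 1), (-1 : R) ^ (p + (j : ℕ) + 1) *
      (f (fun i => Fin.contractNth (n := p + q) ⟨p + j, by omega⟩ (· * ·) x ⟨i, by omega⟩) *
        g (fun i => Fin.contractNth (n := p + q) ⟨p + j, by omega⟩ (· * ·) x ⟨p + i, by omega⟩)) =
      (-1 : R) ^ p * (f (fun i => x ⟨i, by omega⟩) * ((-1 : R) ^ ((j : ℕ) + 1) *
        g (Fin.contractNth j (· * ·) (fun i : Fin (q + 1) => x ⟨p + i, by omega⟩)))) := by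
    intro j
    rw [hF f (t3 j), hF g (t4 j), add_assoc, pow_add]
    ring
  rw [Finset.sum_congr rfl fun j _ => s1 j, Finset.sum_congr rfl fun j _ => s2 j,
    ← Finset.sum_mul, ← Finset.mul_sum, ← Finset.mul_sum, hF f t5, Fin.val_last]
  have u1 : (g fun i => x (⟨p + i, by omega⟩ : Fin (p + q)).succ) =
      g fun i => x ⟨p + 1 + i, by omega⟩ :=
    hF g fun i => congrArg x (Fin.ext (by simp; omega))
  have u2 : (g fun i : Fin q => x ⟨p + i.succ, by grind⟩) =
      g fun i => x ⟨p + 1 + i, by omega⟩ :=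
    hF g fun i => congrArg x (Fin.ext (by simp; omega))
  rw [u1, u2]
  change (f fun i => x ⟨i + 1, by omega⟩) * _ + _ = ((f fun i => x ⟨i + 1, by omega⟩) + _) * _ + _
  ring

theorem dCochain_iCocycles {n : ℕ} (x : groupCohomology.cocycles (Rep.trivial k G R) n) :
    dCochain k (groupCohomology.iCocycles (Rep.trivial k G R) n x) = 0 := by
  have := congrArg (fun φ => φ.hom x)
    ((groupCohomology.inhomogeneousCochains (Rep.trivial k G R)).iCycles_d n (n + 1))
  rw [groupCohomology.inhomogeneousCochains.d_def] at this
  exact this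

theorem dCochain_cup_cocycles {p q n : ℕ} (h : p + q = n)
    (x : groupCohomology.cocycles (Rep.trivial k G R) p)
    (y : groupCohomology.cocycles (Rep.trivial k G R) q) :
    dCochain k (cupCochain h (groupCohomology.iCocycles _ p x : (Fin p → G) → R)
      (groupCohomology.iCocycles _ q y)) = 0 := by
  rw [dCochain_cupCochain, dCochain_iCocycles, dCochain_iCocycles, cupCochain_zero_left,
    cupCochain_zero_right, smul_zero, add_zero]

/-- The cup product of cocycles. -/
def cupCocycle {p q n : ℕ} (h : p + q = n)
    (x : groupCohomology.cocycles (Rep.trivial k G R) p)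
    (y : groupCohomology.cocycles (Rep.trivial k G R) q) :
    groupCohomology.cocycles (Rep.trivial k G R) n :=
  groupCohomology.cocyclesMk (A := Rep.trivial k G R)
    (cupCochain h (groupCohomology.iCocycles _ p x : (Fin p → G) → R)
      (groupCohomology.iCocycles _ q y)) (dCochain_cup_cocycles h x y)

theorem iCocycles_cupCocycle {p q n : ℕ} (h : p + q = n)
    (x : groupCohomology.cocycles (Rep.trivial k G R) p)
    (y : groupCohomology.cocycles (Rep.trivial k G R) q) :
    groupCohomology.iCocycles _ n (cupCocycle h x y) =
      cupCochain h (groupCohomology.iCocycles _ p x : (Fin p → G) → R)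
        (groupCohomology.iCocycles _ q y) :=
  groupCohomology.iCocycles_mk (A := Rep.trivial k G R) _ (dCochain_cup_cocycles h x y)

theorem cohomology_π_eq_zero_iff {n : ℕ} (x : groupCohomology.cocycles (Rep.trivial k G R) n) :
    groupCohomology.π _ n x = 0 ↔ (groupCohomology.iCocycles _ n x : (Fin n → G) → R) = 0 ∨
      ∃ (m : ℕ) (h : n = m + 1) (b : (Fin m → G) → R),
        (fun z => groupCohomology.iCocycles _ n x z) =
          fun z => dCochain k b (fun i => z (Fin.cast h.symm i)) := by
  set K := groupCohomology.inhomogeneousCochains (Rep.trivial k G R) with hK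
  have hinj : Function.Injective (K.iCycles n) :=
    (ModuleCat.mono_iff_injective _).1 inferInstance
  constructor
  · intro hx
    have hex := ShortComplex.exact_of_g_is_cokernel
      (.mk (K.toCycles ((ComplexShape.up ℕ).prev n) n) (K.homologyπ n) (by simp))
      (K.homologyIsCokernel _ n rfl)
    obtain ⟨b, hb⟩ := (ShortComplex.moduleCat_exact_iff _).1 hex x hx
    have hb' : K.d _ n b = K.iCycles n x := by
      rw [← K.toCycles_i _ n]
      exact congrArg (K.iCycles n) hb
    cases n with
    | zero =>
      left
      refine hb'.symm.trans ?_
      rw [K.shape _ _ (by simp)]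
      rfl
    | succ m =>
      right
      have hp : (ComplexShape.up ℕ).prev (m + 1) = m := by simp
      revert b hb'
      rw [hp]
      intro b _ hb'
      refine ⟨m, rfl, b, ?_⟩
      rw [groupCohomology.inhomogeneousCochains.d_def] at hb'
      exact hb'.symm
  · rintro (hx | ⟨m, rfl, b, hb⟩)
    · rw [show x = 0 from hinj (hx.trans (map_zero (K.iCycles n).hom).symm), map_zero]
    · have : x = K.toCycles m (m + 1) b := by
        apply hinj
        refine Eq.trans ?_ (congrArg (fun φ => φ.hom b) (K.toCycles_i m (m + 1))).symm
        rw [groupCohomology.inhomogeneousCochains.d_def]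
        exact hb
      rw [this]
      exact congrArg (fun φ => φ.hom b) (K.toCycles_comp_homologyπ m (m + 1))

theorem iCocycles_injective (k G R : Type) [CommRing k] [Group G] [CommRing R] [Algebra k R]
    (n : ℕ) : Function.Injective (groupCohomology.iCocycles (Rep.trivial k G R) n) :=
  (ModuleCat.mono_iff_injective _).1 inferInstance

theorem π_cupCocycle_left {p q n : ℕ} (h : p + q = n)
    (x x' : groupCohomology.cocycles (Rep.trivial k G R) p)
    (y : groupCohomology.cocycles (Rep.trivial k G R) q)
    (hx : groupCohomology.π _ p x = groupCohomology.π _ p x') :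
    groupCohomology.π _ n (cupCocycle h x y) = groupCohomology.π _ n (cupCocycle h x' y) := by
  rw [← sub_eq_zero, ← map_sub, cohomology_π_eq_zero_iff] at hx ⊢
  rw [map_sub] at hx
  have e : groupCohomology.iCocycles _ n (cupCocycle h x y - cupCocycle h x' y) =
      cupCochain h (groupCohomology.iCocycles _ p x - groupCohomology.iCocycles _ p x' :
        (Fin p → G) → R) (groupCohomology.iCocycles _ q y) := by
    rw [map_sub, iCocycles_cupCocycle, iCocycles_cupCocycle]
    exact (cupCochain_sub_left ..).symm
  rcases hx with hx | ⟨m, rfl, b, hb⟩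
  · left
    refine e.trans ?_
    refine (congrArg (fun f => cupCochain h f _) hx).trans ?_
    exact cupCochain_zero_left ..
  · right
    obtain ⟨n, rfl⟩ : ∃ n', n = n' + 1 := ⟨m + q, by omega⟩
    refine ⟨n, rfl, cupCochain (show m + q = n by omega) b (groupCohomology.iCocycles _ q y), ?_⟩
    refine e.trans ?_
    refine (congrArg (fun f => cupCochain h f _) hb).trans ?_
    refine Eq.trans ?_ (dCochain_cupCochain (k := k) (show m + q = n by omega) b _).symm
    rw [dCochain_iCocycles, cupCochain_zero_right, smul_zero, add_zero]
    rfl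

theorem π_cupCocycle_right {p q n : ℕ} (h : p + q = n)
    (x : groupCohomology.cocycles (Rep.trivial k G R) p)
    (y y' : groupCohomology.cocycles (Rep.trivial k G R) q)
    (hy : groupCohomology.π _ q y = groupCohomology.π _ q y') :
    groupCohomology.π _ n (cupCocycle h x y) = groupCohomology.π _ n (cupCocycle h x y') := by
  rw [← sub_eq_zero, ← map_sub, cohomology_π_eq_zero_iff] at hy ⊢
  rw [map_sub] at hy
  have e : groupCohomology.iCocycles _ n (cupCocycle h x y - cupCocycle h x y') =
      cupCochain h (groupCohomology.iCocycles _ p x : (Fin p → G) → R)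
        (groupCohomology.iCocycles _ q y - groupCohomology.iCocycles _ q y') := by
    rw [map_sub, iCocycles_cupCocycle, iCocycles_cupCocycle]
    exact (cupCochain_sub_right ..).symm
  rcases hy with hy | ⟨m, rfl, b, hb⟩
  · left
    refine e.trans ?_
    refine (congrArg (fun f => cupCochain h _ f) hy).trans ?_
    exact cupCochain_zero_right ..
  · right
    obtain ⟨n, rfl⟩ : ∃ n', n = n' + 1 := ⟨p + m, by omega⟩
    have hd := dCochain_cupCochain (k := k) (show p + m = n by omega)
      (groupCohomology.iCocycles _ p x : (Fin p → G) → R) b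
    rw [dCochain_iCocycles, cupCochain_zero_left, zero_add] at hd
    refine ⟨n, rfl, (-1 : k) ^ p • cupCochain (show p + m = n by omega)
      (groupCohomology.iCocycles _ p x : (Fin p → G) → R) b, ?_⟩
    refine e.trans ?_
    refine (congrArg (fun f => cupCochain h _ f) hb).trans ?_
    refine Eq.trans ?_ (map_smul (inhomogeneousCochains.d (Rep.trivial k G R) n).hom _ _).symm
    refine Eq.trans ?_ (congrArg (fun f => (-1 : k) ^ p • f) hd).symm
    rcases Nat.even_or_odd p with hp | hp
    · rw [hp.neg_one_pow, hp.neg_one_pow, one_smul, one_smul]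
      rfl
    · rw [hp.neg_one_pow, hp.neg_one_pow, neg_smul, one_smul, neg_smul, one_smul, neg_neg]
      rfl

theorem π_surjective (k G R : Type) [CommRing k] [Group G] [CommRing R] [Algebra k R] (n : ℕ) :
    Function.Surjective (groupCohomology.π (Rep.trivial k G R) n) := fun x =>
  groupCohomology_induction_on x fun y => ⟨y, rfl⟩

/-- The cup product `H^p(G; R) × H^q(G; R) → H^n(G; R)`, `p + q = n`, computed on cocycles that
represent the two classes. -/
def cup {p q n : ℕ} (h : p + q = n) (x : groupCohomology (Rep.trivial k G R) p)
    (y : groupCohomology (Rep.trivial k G R) q) : groupCohomology (Rep.trivial k G R) n :=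
  groupCohomology.π _ n (cupCocycle h (Function.surjInv (π_surjective k G R p) x)
    (Function.surjInv (π_surjective k G R q) y))

/-- The cup product does not depend on the cocycles that represent the classes. -/
theorem cup_π {p q n : ℕ} (h : p + q = n)
    (x : groupCohomology.cocycles (Rep.trivial k G R) p)
    (y : groupCohomology.cocycles (Rep.trivial k G R) q) :
    cup h (groupCohomology.π _ p x) (groupCohomology.π _ q y) =
      groupCohomology.π _ n (cupCocycle h x y) :=
  (π_cupCocycle_left h _ _ _ (Function.surjInv_eq (π_surjective k G R p) _)).trans
    (π_cupCocycle_right h _ _ _ (Function.surjInv_eq (π_surjective k G R q) _))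

theorem dCochain_one : dCochain k (fun _ : Fin 0 → G => (1 : R)) = 0 := by
  funext x
  simp [dCochain_apply]

variable (G R k) in
/-- The unit `1 ∈ H⁰(G; R)`, the class of the constant `0`-cochain `1`. -/
def cohomologyOne : groupCohomology (Rep.trivial k G R) 0 :=
  groupCohomology.π _ 0
    (groupCohomology.cocyclesMk (A := Rep.trivial k G R) (fun _ => (1 : R)) dCochain_one)

/-- The power `x^m ∈ H^{pm}(G; R)` of a class `x ∈ H^p(G; R)` under the cup product. -/
def cupPow {p : ℕ} (x : groupCohomology (Rep.trivial k G R) p) :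
    (m : ℕ) → groupCohomology (Rep.trivial k G R) (p * m)
  | 0 => cohomologyOne G R k
  | m + 1 => cup (Nat.mul_succ p m).symm (cupPow x m) x

end Cup

/-- The map `H^n(G; ℤ) → H^n(G; ℚ)` induced by `ℤ → ℚ` on coefficients. -/
def toRational (G : Type) [Group G] (n : ℕ) :
    groupCohomology (Rep.trivial ℤ G ℤ) n ⟶ groupCohomology (Rep.trivial ℤ G ℚ) n :=
  groupCohomology.map (MonoidHom.id G)
    (Rep.ofHom ⟨(Int.castAddHom ℚ).toIntLinearMap, fun _ => rfl⟩ :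
      Rep.trivial ℤ G ℤ ⟶ Rep.trivial ℤ G ℚ) n

/-- The map `H_n(Γ; ℤ) → H_n(G; ℤ)` induced by the inclusion of a subgroup `Γ ⊆ G`. -/
def homologyInclusion {G : Type} [Group G] (Γ : Subgroup G) (n : ℕ) :
    groupHomology (Rep.trivial ℤ Γ ℤ) n ⟶ groupHomology (Rep.trivial ℤ G ℤ) n :=
  groupHomology.map Γ.subtype (𝟙 (Rep.trivial ℤ Γ ℤ)) n

/-- The integral Euler class `χ ∈ H²(G; ℤ)`, `G = Diff^ω_+ S¹`: the class of the central extension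
of `G` by its universal covering group. -/
def eulerClass : groupCohomology (Rep.trivial ℤ AnalyticDiff ℤ) 2 :=
  universalCoverExtension.classOf universalCoverExtension_central
    ⟨Function.surjInv universalCoverExtension.rightHom_surjective,
      Function.rightInverse_surjInv universalCoverExtension.rightHom_surjective⟩

/-- The rational Euler class `χ ∈ H²(G; ℚ)`. -/
def rationalEulerClass : groupCohomology (Rep.trivial ℤ AnalyticDiff ℚ) 2 :=
  toRational AnalyticDiff 2 eulerClass

end

/-! If `χ^k` were rationally zero, it would be the Bockstein of a class in `H^(2k-1)(G; ℚ/ℤ)`. Since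
`ℚ/ℤ` is injective, such a class restricts to `Γ = ℤ/n` through `H_(2k-1)(Γ) → H_(2k-1)(G)`, which
is zero; so `χ^k` would vanish in `H^(2k)(Γ; ℤ) = ℤ/n`. But `χ` restricts to a generator of `H²(Γ;
ℤ)`, and so does its power in degree `2k`.

The proof carries this out on bar chains. Let `s` generate `Γ`, let `w` be the sum of all
`[i₀|s|⋯|iₘ|s]` with `m + 1 = k`, and `z` the sum of all `[s|i₀|s|⋯|iₘ₋₁|s]`. Then `∂w = n z`
(`sum_boundary_alternatingTuple`), so `z` is a cycle, and by hypothesis `z = ∂y` for an integral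
chain `y` of `G`. Let `f` be an integral cocycle for `χ`. If `f^k = δb` with `b` rational, then
`⟨f^k, w⟩ = ⟨b, ∂w⟩ = n ⟨b, ∂y⟩ = n ⟨f^k, y⟩` is a multiple of `n`
(`exists_sum_dCochain_eq_card_mul`). On the other hand `⟨f^k, w⟩ = (∑ g, f(g, s))^k`
(`card_dvd_sum_pow`), and the inner sum is `1` modulo `n` (`sum_sectionCocycle_rotation`), which is
impossible for `n ≥ 2`. -/

/-! ### Bar chains of a finite group and their boundaries. -/

section Bar

variable {Γ M : Type}

/-- The tuple `(i₀, s, i₁, s, …, iₘ, s)`. -/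
def alternatingTuple (s : Γ) {m : ℕ} (i : Fin (m + 1) → Γ) (p : Fin (2 * m + 1 + 1)) : Γ :=
  if (p : ℕ) % 2 = 0 then i ⟨p / 2, by omega⟩ else s

/-- The tuple `(s, i₀, s, i₁, …, iₘ₋₁, s)`. -/
def alternatingTupleOdd (s : Γ) {m : ℕ} (i : Fin m → Γ) (p : Fin (2 * m + 1)) : Γ :=
  if h : (p : ℕ) % 2 = 0 then s else i ⟨p / 2, by omega⟩

theorem alternatingTuple_cons_succ (s a : Γ) {m : ℕ} (i : Fin m → Γ) :
    (fun p : Fin (2 * m + 1) =>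
      alternatingTuple s (Fin.cons a i : Fin (m + 1) → Γ) p.succ) = alternatingTupleOdd s i := by
  funext p
  by_cases h : (p : ℕ) % 2 = 0
  · have h' : ¬ ((p : ℕ) + 1) % 2 = 0 := by omega
    simp [alternatingTuple, alternatingTupleOdd, h, h']
  · have h' : ((p : ℕ) + 1) % 2 = 0 := by omega
    have e : (⟨((p : ℕ) + 1) / 2, by omega⟩ : Fin (m + 1)) =
        Fin.succ (⟨p / 2, by omega⟩ : Fin m) := Fin.ext (by simp; omega)
    rw [alternatingTuple, alternatingTupleOdd, if_pos (show (p.succ : ℕ) % 2 = 0 from h'),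
      dif_neg h]
    exact (congrArg (Fin.cons a i : Fin (m + 1) → Γ) e).trans (Fin.cons_succ ..)

variable [Group Γ] [AddCommGroup M]

/-- Multiply the entry `r` by `s` on the right and the entry `r + 1` by `s⁻¹` on the left. -/
def adjacentShift (s : Γ) (m r : ℕ) : (Fin m → Γ) ≃ (Fin m → Γ) :=
  Equiv.piCongrRight fun t =>
    if (t : ℕ) = r then Equiv.mulRight s
    else if (t : ℕ) = r + 1 then Equiv.mulLeft s⁻¹ else Equiv.refl Γ

/-- Face `2r` merges `iᵣ` with the `s` after it. In the shifted tuple `iᵣ s` is already present, and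
face `2r + 1` merges `s` with `s⁻¹ iᵣ₊₁`, restoring `iᵣ₊₁`. For `r = m` there is no `iᵣ₊₁`, and face
`2m + 1` drops the final `s` instead. Summed over all `i`, the two faces therefore cancel. -/
theorem contractNth_alternatingTuple (s : Γ) {m : ℕ} (i : Fin (m + 1) → Γ) (r : ℕ)
    (hr : r < m + 1) :
    Fin.contractNth ⟨2 * r, by omega⟩ (· * ·) (alternatingTuple s i) =
      Fin.contractNth ⟨2 * r + 1, by omega⟩ (· * ·)
        (alternatingTuple s (adjacentShift s (m + 1) r i)) := by
  funext p
  obtain ⟨p, hp⟩ := p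
  have key : ∀ q (hq : q < 2 * m + 1 + 1) (t) (ht : t < m + 1), q = 2 * t →
      alternatingTuple s i ⟨q, hq⟩ = i ⟨t, ht⟩ := by
    rintro q hq t ht rfl
    simp [alternatingTuple]
  have key' : ∀ q (hq : q < 2 * m + 1 + 1) (t) (ht : t < m + 1), q = 2 * t →
      alternatingTuple s (adjacentShift s (m + 1) r i) ⟨q, hq⟩ =
        adjacentShift s (m + 1) r i ⟨t, ht⟩ := by
    rintro q hq t ht rfl
    simp [alternatingTuple]
  have odd : ∀ (j : Fin (m + 1) → Γ) q (hq : q < 2 * m + 1 + 1), q % 2 = 1 →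
      alternatingTuple s j ⟨q, hq⟩ = s := by
    intro j q hq h
    simp [alternatingTuple, h]
  have hs : ∀ t (ht : t < m + 1), t ≠ r → t ≠ r + 1 →
      adjacentShift s (m + 1) r i ⟨t, ht⟩ = i ⟨t, ht⟩ := by
    intro t ht h1 h2
    simp [adjacentShift, h1, h2]
  have hs0 : ∀ (ht : r < m + 1), adjacentShift s (m + 1) r i ⟨r, ht⟩ = i ⟨r, ht⟩ * s := by
    intro ht
    simp [adjacentShift]
  have hs1 : ∀ (ht : r + 1 < m + 1),
      adjacentShift s (m + 1) r i ⟨r + 1, ht⟩ = s⁻¹ * i ⟨r + 1, ht⟩ := by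
    intro ht
    simp [adjacentShift]
  simp only [Fin.contractNth, Fin.castSucc_mk, Fin.succ_mk]
  rcases lt_trichotomy p (2 * r) with h | h | h
  · rw [if_pos h, if_pos (by omega)]
    rcases Nat.even_or_odd' p with ⟨t, ht | ht⟩
    · rw [key _ _ t (by omega) ht, key' _ _ t (by omega) ht, hs t _ (by omega) (by omega)]
    · rw [odd _ _ _ (by omega), odd _ _ _ (by omega)]
  · subst h
    rw [if_neg (by omega), if_pos rfl, if_pos (by omega), key _ _ r hr rfl, key' _ _ r hr rfl,
      odd _ _ _ (by omega), hs0]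
  · rw [if_neg (by omega), if_neg (by omega), if_neg (by omega)]
    by_cases h1 : p = 2 * r + 1
    · subst h1
      rw [if_pos rfl, key _ _ (r + 1) (by omega) (by ring), odd _ _ _ (by omega),
        key' _ _ (r + 1) (by omega) (by ring), hs1, mul_inv_cancel_left]
    · rw [if_neg h1]
      rcases Nat.even_or_odd' p with ⟨t, ht | ht⟩
      · rw [odd _ _ _ (by omega), odd _ _ _ (by omega)]
      · rw [key _ _ (t + 1) (by omega) (by omega), key' _ _ (t + 1) (by omega) (by omega),
          hs _ _ (by omega) (by omega)]

theorem sum_alternating_eq_zero (n : ℕ) (f : Fin (2 * n) → M)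
    (hf : ∀ r (hr : r < n), f ⟨2 * r, by omega⟩ = f ⟨2 * r + 1, by omega⟩) :
    ∑ j : Fin (2 * n), (-1 : ℤ) ^ ((j : ℕ) + 1) • f j = 0 := by
  induction n with
  | zero => rfl
  | succ n ih =>
    refine (Fin.sum_univ_castSucc (n := 2 * n + 1) _).trans ?_
    rw [Fin.sum_univ_castSucc (n := 2 * n)]
    have ih' := ih (fun j => f j.castSucc.castSucc) fun r hr => hf r (by omega)
    have e1 : f (Fin.castSucc (Fin.last (2 * n))) = f (Fin.last (2 * n + 1)) := hf n (by omega)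
    change ∑ j : Fin (2 * n), (-1 : ℤ) ^ ((j : ℕ) + 1) • f j.castSucc.castSucc +
      (-1 : ℤ) ^ (2 * n + 1) • f (Fin.castSucc (Fin.last (2 * n))) +
      (-1 : ℤ) ^ (2 * n + 1 + 1) • f (Fin.last (2 * n + 1)) = 0
    rw [ih', e1, pow_succ _ (2 * n + 1), mul_neg_one, neg_smul, zero_add, add_neg_cancel]

/-- The boundary of the bar chain `∑ [i₀|s|⋯|iₘ|s]` is `|Γ| ∑ [s|i₀|s|⋯|iₘ₋₁|s]`. -/
theorem sum_boundary_alternatingTuple [Fintype Γ] (s : Γ) (m : ℕ)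
    (F : (Fin (2 * m + 1) → Γ) → M) :
    ∑ i : Fin (m + 1) → Γ, (F (fun p => alternatingTuple s i p.succ) +
        ∑ j : Fin (2 * m + 1 + 1),
          (-1 : ℤ) ^ ((j : ℕ) + 1) • F (Fin.contractNth j (· * ·) (alternatingTuple s i))) =
      Fintype.card Γ • ∑ i : Fin m → Γ, F (alternatingTupleOdd s i) := by
  rw [Finset.sum_add_distrib, Finset.sum_comm]
  simp only [← Finset.smul_sum]
  refine (congrArg₂ (· + ·) ?_ (sum_alternating_eq_zero (m + 1)
    (fun j : Fin (2 * m + 1 + 1) => ∑ i : Fin (m + 1) → Γ,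
      F (Fin.contractNth j (· * ·) (alternatingTuple s i))) ?_)).trans (add_zero _)
  -- The zeroth face forgets `i₀`, so summing over `i₀` only contributes the factor `|Γ|`.
  · rw [← (Fin.consEquiv fun _ => Γ).sum_comp, Fintype.sum_prod_type]
    change ∑ a, ∑ i : Fin m → Γ,
      F (fun p => alternatingTuple s (Fin.cons a i : Fin (m + 1) → Γ) p.succ) = _
    simp [alternatingTuple_cons_succ]
  · intro r hr
    simp only [contractNth_alternatingTuple s _ r hr]
    -- The shift permutes the tuples `i`, so it disappears from the sum.
    exact (adjacentShift s (m + 1) r).sum_comp fun i =>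
      F (Fin.contractNth ⟨2 * r + 1, by omega⟩ (· * ·) (alternatingTuple s i))

end Bar

/-! ### Pairing rational cochains with integral chains. -/

section Pairing

variable {G : Type} [Group G]

/-- Stokes' formula `⟨δb, y⟩ = ⟨b, ∂y⟩`; both sides are additive in `y`, and on a basis chain the
two differentials have the same faces and signs. -/
theorem linearCombination_dCochain {n : ℕ} (b : (Fin n → G) → ℚ)
    (y : (Fin (n + 1) → G) →₀ ℤ) :
    Finsupp.linearCombination ℤ (dCochain ℤ b) y = Finsupp.linearCombination ℤ b
      (groupHomology.inhomogeneousChains.d (Rep.trivial ℤ G ℤ) n y : (Fin n → G) →₀ ℤ) := by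
  induction y using Finsupp.induction_linear with
  | zero =>
    rw [map_zero]
    exact (((Finsupp.linearCombination ℤ b).comp (groupHomology.inhomogeneousChains.d
      (Rep.trivial ℤ G ℤ) n).hom).map_zero).symm
  | add y z hy hz =>
    rw [map_add, hy, hz]
    exact (((Finsupp.linearCombination ℤ b).comp (groupHomology.inhomogeneousChains.d
      (Rep.trivial ℤ G ℤ) n).hom).map_add y z).symm
  | single x a =>
    refine Eq.trans ?_ (congrArg (Finsupp.linearCombination ℤ b)
      (groupHomology.inhomogeneousChains.d_single (A := Rep.trivial ℤ G ℤ) n x a)).symm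
    rw [Finsupp.linearCombination_single, dCochain_apply]
    have e : ∀ p : Fin n → G, Finsupp.linearCombination ℤ b (Finsupp.single p a) = a • b p :=
      fun p => Finsupp.linearCombination_single ..
    refine Eq.trans ?_ (map_add (Finsupp.linearCombination ℤ b) _ _).symm
    rw [smul_add]
    congr 1
    · exact (e _).symm
    · refine Eq.trans ?_ (map_sum (Finsupp.linearCombination ℤ b) _ _).symm
      rw [Finset.smul_sum]
      refine Finset.sum_congr rfl fun j _ => ?_
      refine Eq.trans ?_ (map_smul (Finsupp.linearCombination ℤ b) _ _).symm
      refine Eq.trans ?_ (congrArg _ (e _).symm)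
      rw [smul_comm]
      congr 1
      simp

theorem exists_int_linearCombination {X : Type} (f : X → ℚ) (hf : ∀ x, ∃ c : ℤ, f x = c)
    (y : X →₀ ℤ) : ∃ c : ℤ, Finsupp.linearCombination ℤ f y = c := by
  choose g hg using hf
  refine ⟨y.sum fun x a => a * g x, ?_⟩
  simp [Finsupp.linearCombination_apply, Finsupp.sum, hg]

theorem chainsMap_subtype_apply (Γ : Subgroup G) (n : ℕ) (z : (Fin n → Γ) →₀ ℤ) :
    ((groupHomology.chainsMap (B := Rep.trivial ℤ G ℤ) Γ.subtype
      (𝟙 (Rep.trivial ℤ Γ ℤ))).f n).hom z = z.mapDomain fun x p => (x p : G) := by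
  change Finsupp.mapRange id rfl (z.mapDomain fun x p => (x p : G)) = _
  exact Finsupp.mapRange_id _

theorem exists_boundary_of_π_eq_zero {n : ℕ}
    (z : groupHomology.cycles (Rep.trivial ℤ G ℤ) n) (hz : groupHomology.π _ n z = 0) :
    ∃ y : (Fin (n + 1) → G) →₀ ℤ, (groupHomology.inhomogeneousChains.d
      (Rep.trivial ℤ G ℤ) n).hom y = (groupHomology.iCycles _ n).hom z := by
  set K := groupHomology.inhomogeneousChains (Rep.trivial ℤ G ℤ) with hK
  have hex := ShortComplex.exact_of_g_is_cokernel
      (.mk (K.toCycles (n + 1) n) (K.homologyπ n) (by simp))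
      (K.homologyIsCokernel _ _ (by simp))
  obtain ⟨y, hy⟩ := (ShortComplex.moduleCat_exact_iff _).1 hex z hz
  refine ⟨y, ?_⟩
  rw [← groupHomology.inhomogeneousChains.d_def, ← K.toCycles_i]
  exact congrArg (K.iCycles n) hy

/-- Puts the vanishing on homology in the form the pairing needs: an actual integral bar chain of
`G` that bounds the pushforward of `z`. -/
theorem exists_boundary_of_homologyInclusion_eq_zero {Γ : Subgroup G} {n : ℕ}
    (h : homologyInclusion Γ (n + 1) = 0) (z : (Fin (n + 1) → Γ) →₀ ℤ)
    (hz : (groupHomology.inhomogeneousChains.d (Rep.trivial ℤ Γ ℤ) n).hom z = 0) :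
    ∃ y : (Fin (n + 1 + 1) → G) →₀ ℤ,
      (groupHomology.inhomogeneousChains.d (Rep.trivial ℤ G ℤ) (n + 1)).hom y =
        z.mapDomain fun x p => (x p : G) := by
  have hz' : (groupHomology.inhomogeneousChains (Rep.trivial ℤ Γ ℤ)).d (n + 1) n z = 0 := by
    rw [groupHomology.inhomogeneousChains.d_def]
    exact hz
  have hi := groupHomology.iCycles_mk (A := Rep.trivial ℤ Γ ℤ) (n := n) (by simp) z hz'
  set ζ := groupHomology.cyclesMk (A := Rep.trivial ℤ Γ ℤ) (n + 1) n (by simp) z hz'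
  have h0 : groupHomology.π _ (n + 1) (groupHomology.cyclesMap (B := Rep.trivial ℤ G ℤ) Γ.subtype
      (𝟙 (Rep.trivial ℤ Γ ℤ)) (n + 1) ζ) = 0 :=
    (congrArg (fun φ => φ.hom ζ) (groupHomology.π_map (B := Rep.trivial ℤ G ℤ) Γ.subtype
      (𝟙 (Rep.trivial ℤ Γ ℤ)) (n + 1))).symm.trans
        (congrArg (fun φ => φ.hom (groupHomology.π _ _ ζ)) h)
  obtain ⟨y, hy⟩ := exists_boundary_of_π_eq_zero _ h0
  refine ⟨y, hy.trans ?_⟩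
  refine (congrArg (fun φ => φ.hom ζ) (HomologicalComplex.cyclesMap_i
    (groupHomology.chainsMap (B := Rep.trivial ℤ G ℤ) Γ.subtype (𝟙 (Rep.trivial ℤ Γ ℤ)))
      (n + 1))).trans ?_
  refine Eq.trans ?_ (chainsMap_subtype_apply Γ (n + 1) z)
  exact congrArg ((groupHomology.chainsMap (B := Rep.trivial ℤ G ℤ) Γ.subtype
    (𝟙 (Rep.trivial ℤ Γ ℤ))).f (n + 1)).hom hi

/-- If the homology of the finite subgroup `Γ` dies in `G` in degree `2m + 1` and `b` is a rational
cochain of that degree whose coboundary is integral, then the sum of the values of the coboundary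
at the tuples `(i₀, s, …, iₘ, s)` is divisible by the order of `Γ`. -/
theorem exists_sum_dCochain_eq_card_mul {Γ : Subgroup G} [Fintype Γ] (s : Γ) (m : ℕ)
    (h : homologyInclusion Γ (2 * m + 1) = 0) (b : (Fin (2 * m + 1) → G) → ℚ)
    (hb : ∀ x, ∃ c : ℤ, dCochain ℤ b x = c) :
    ∃ c : ℤ, ∑ i : Fin (m + 1) → Γ, dCochain ℤ b (fun p => ((alternatingTuple s i p : Γ) : G)) =
      Fintype.card Γ * c := by
  set z : (Fin (2 * m + 1) → Γ) →₀ ℤ :=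
    ∑ i : Fin m → Γ, Finsupp.single (alternatingTupleOdd s i) 1 with hz
  set w : (Fin (2 * m + 1 + 1) → Γ) →₀ ℤ :=
    ∑ i : Fin (m + 1) → Γ, Finsupp.single (alternatingTuple s i) 1 with hw
  have hwz : (groupHomology.inhomogeneousChains.d (Rep.trivial ℤ Γ ℤ) (2 * m + 1)).hom w =
      Fintype.card Γ • z := by
    refine Eq.trans ?_ (sum_boundary_alternatingTuple s m fun x => Finsupp.single x (1 : ℤ))
    rw [hw]
    refine (map_sum (groupHomology.inhomogeneousChains.d (Rep.trivial ℤ Γ ℤ) (2 * m + 1)).hom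
      _ _).trans ?_
    refine Finset.sum_congr rfl fun i _ => ?_
    exact groupHomology.inhomogeneousChains.d_single (A := Rep.trivial ℤ Γ ℤ) _ _ _
  -- `|Γ| ∂z = ∂∂w = 0`, and integral chains are torsion free.
  have hdz : (groupHomology.inhomogeneousChains.d (Rep.trivial ℤ Γ ℤ) (2 * m)).hom z = 0 := by
    have e : (groupHomology.inhomogeneousChains.d (Rep.trivial ℤ Γ ℤ) (2 * m)).hom
        (Fintype.card Γ • z : (Fin (2 * m + 1) → Γ) →₀ ℤ) = 0 := by
      rw [← hwz]
      exact congrArg (fun φ => φ.hom w)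
        (groupHomology.inhomogeneousChains.d_comp_d (A := Rep.trivial ℤ Γ ℤ) (n := 2 * m))
    have e' : Fintype.card Γ • ((groupHomology.inhomogeneousChains.d (Rep.trivial ℤ Γ ℤ)
        (2 * m)).hom z : (Fin (2 * m) → Γ) →₀ ℤ) = 0 :=
      (map_nsmul (groupHomology.inhomogeneousChains.d (Rep.trivial ℤ Γ ℤ) (2 * m)).hom
        _ _).symm.trans e
    exact (smul_eq_zero.1 e').resolve_left Fintype.card_ne_zero
  obtain ⟨y, hy⟩ := exists_boundary_of_homologyInclusion_eq_zero h z hdz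
  obtain ⟨c, hc⟩ := exists_int_linearCombination (dCochain ℤ b) hb y
  refine ⟨c, ?_⟩
  -- `c = ⟨δb, y⟩ = ⟨b, ∂y⟩ = ⟨b, z⟩`, an integer although `b` itself is only rational.
  rw [← hc, linearCombination_dCochain, hy, Finsupp.linearCombination_mapDomain, hz, map_sum]
  simp only [Finsupp.linearCombination_single, one_smul, Function.comp_apply]
  -- The boundary formula again, now with `F` the restriction of `b` to `Γ`: it turns `|Γ| ⟨b, z⟩`
  -- into `⟨δb, w⟩`.
  rw [← nsmul_eq_mul, ← sum_boundary_alternatingTuple s m fun x => b fun p => (x p : G)]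
  refine Finset.sum_congr rfl fun i _ => ?_
  rw [dCochain_apply]
  congr 1
  refine Finset.sum_congr rfl fun j _ => ?_
  rw [zsmul_eq_mul]
  push_cast
  congr 2
  exact (Fin.comp_contractNth (· * ·) (· * ·) (fun _ _ => rfl) j (alternatingTuple s i)).symm

end Pairing

/-! ### Explicit cocycles for powers of a degree two class. -/

section EulerPower

variable {G : Type} [Group G]

/-- In the cup product of cochains each factor reads its own consecutive pair of arguments. This
product form is what makes the sum over alternating tuples factor. -/
theorem exists_cocycle_cupPow {k R : Type} [CommRing k] [CommRing R] [Algebra k R]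
    (x : groupCohomology.cocycles (Rep.trivial k G R) 2) (c : G → G → R)
    (hx : ∀ z : Fin 2 → G, groupCohomology.iCocycles _ 2 x z = c (z 0) (z 1)) (m : ℕ) :
    ∃ y : groupCohomology.cocycles (Rep.trivial k G R) (2 * m),
      groupCohomology.π _ _ y = cupPow (groupCohomology.π _ 2 x) m ∧
      ∀ z : Fin (2 * m) → G, groupCohomology.iCocycles _ (2 * m) y z =
        ∏ t : Fin m, c (z ⟨2 * t, by omega⟩) (z ⟨2 * t + 1, by omega⟩) := by
  induction m with
  | zero =>
    refine ⟨_, rfl, fun z => ?_⟩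
    refine (congrFun (groupCohomology.iCocycles_mk (A := Rep.trivial k G R)
      (fun _ : Fin 0 → G => (1 : R)) dCochain_one) z).trans ?_
    simp
  | succ m ih =>
    obtain ⟨y, hy, hyz⟩ := ih
    refine ⟨cupCocycle (Nat.mul_succ 2 m).symm y x, ?_, fun z => ?_⟩
    · rw [← cup_π, hy]
      rfl
    · refine (congrFun (iCocycles_cupCocycle (Nat.mul_succ 2 m).symm y x) z).trans ?_
      rw [cupCochain, Fin.prod_univ_castSucc]
      refine congrArg₂ (· * ·) (hyz _) (hx _)

theorem exists_cocycle_toRational_H2π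
    (f : groupCohomology.cocycles₂ (Rep.trivial ℤ G ℤ)) :
    ∃ x : groupCohomology.cocycles (Rep.trivial ℤ G ℚ) 2,
      groupCohomology.π _ 2 x = toRational G 2 (groupCohomology.H2π _ f) ∧
      ∀ z : Fin 2 → G, groupCohomology.iCocycles _ 2 x z = ((f (z 0, z 1) : ℤ) : ℚ) := by
  let φ : Rep.trivial ℤ G ℤ ⟶ Rep.trivial ℤ G ℚ :=
    Rep.ofHom ⟨(Int.castAddHom ℚ).toIntLinearMap, fun _ => rfl⟩
  let ζ := (groupCohomology.isoCocycles₂ (Rep.trivial ℤ G ℤ)).inv.hom f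
  refine ⟨(groupCohomology.cocyclesMap (A := Rep.trivial ℤ G ℤ) (MonoidHom.id G) φ 2).hom ζ,
    ?_, fun z => ?_⟩
  · exact (congrArg (fun ψ => ψ.hom ζ)
      (groupCohomology.π_map (A := Rep.trivial ℤ G ℤ) (MonoidHom.id G) φ 2)).symm
  · refine (congrFun (congrArg (fun ψ => ψ.hom ζ) (HomologicalComplex.cyclesMap_i
      (groupCohomology.cochainsMap (A := Rep.trivial ℤ G ℤ) (MonoidHom.id G) φ) 2)) z).trans ?_
    exact congrArg (Int.cast : ℤ → ℚ) (congrFun (congrArg (fun ψ => ψ.hom f)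
      (groupCohomology.isoCocycles₂_inv_comp_iCocycles (Rep.trivial ℤ G ℤ))) z)

/-- If the cup power of the rational class of an integral `2`-cocycle vanishes and the homology of a
finite subgroup dies in the complementary degree, then the order of the subgroup divides the power
of the sum of the cocycle over the subgroup. -/
theorem card_dvd_sum_pow {Γ : Subgroup G} [Fintype Γ] (s : Γ) (m : ℕ)
    (h : homologyInclusion Γ (2 * m + 1) = 0)
    (f : groupCohomology.cocycles₂ (Rep.trivial ℤ G ℤ))
    (hf : cupPow (toRational G 2 (groupCohomology.H2π _ f)) (m + 1) = 0) :
    (Fintype.card Γ : ℤ) ∣ (∑ g : Γ, (f ((g : G), (s : G)) : ℤ)) ^ (m + 1) := by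
  obtain ⟨x, hx, hxf⟩ := exists_cocycle_toRational_H2π f
  obtain ⟨y, hy, hyf⟩ := exists_cocycle_cupPow x (fun g g' => ((f (g, g') : ℤ) : ℚ)) hxf (m + 1)
  rw [hx, hf, cohomology_π_eq_zero_iff] at hy
  obtain ⟨b, hb⟩ : ∃ b : (Fin (2 * m + 1) → G) → ℚ, ∀ z : Fin (2 * m + 1 + 1) → G,
      dCochain ℤ b z =
        ((∏ t : Fin (m + 1), (f (z ⟨2 * t, by omega⟩, z ⟨2 * t + 1, by omega⟩) : ℤ) : ℤ) : ℚ) := by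
    -- If the representing cocycle is itself zero, `b = 0` serves as a primitive.
    rcases hy with hy | ⟨m', hm', b, hb⟩
    · refine ⟨0, fun z => ?_⟩
      push_cast
      refine Eq.trans ?_ (hyf z)
      refine Eq.trans ?_ (congrFun hy z).symm
      exact congrFun (map_zero (inhomogeneousCochains.d (Rep.trivial ℤ G ℚ) (2 * m + 1)).hom) z
    · obtain rfl : m' = 2 * m + 1 := by omega
      refine ⟨b, fun z => ?_⟩
      push_cast
      exact (congrFun hb z).symm.trans (hyf z)
  obtain ⟨c, hc⟩ := exists_sum_dCochain_eq_card_mul s m h b fun z => ⟨_, hb z⟩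
  refine ⟨c, ?_⟩
  -- Expanding the power gives a sum over tuples `i` of `∏ f(iₜ, s)`, the value of the cup power at
  -- `(i₀, s, …, iₘ, s)`.
  rw [Fintype.sum_pow]
  have hc' : ((∑ i : Fin (m + 1) → Γ, ∏ t, (f ((i t : G), (s : G)) : ℤ) : ℤ) : ℚ) =
      ((Fintype.card Γ * c : ℤ) : ℚ) := by
    push_cast
    rw [← hc]
    refine Finset.sum_congr rfl fun i _ => ?_
    rw [hb]
    push_cast
    refine Finset.prod_congr rfl fun t _ => ?_
    have e1 : alternatingTuple s i ⟨2 * t, by omega⟩ = i t := by simp [alternatingTuple]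
    have e2 : alternatingTuple s i ⟨2 * t + 1, by omega⟩ = s := by simp [alternatingTuple]
    rw [e1, e2]
  exact_mod_cast hc'

end EulerPower

/-! ### The Euler cocycle on the rotation subgroup. -/

section Rotation

theorem circleRotation_pow (t : ℝ) (j : ℕ) : circleRotation t ^ j = circleRotation (j * t) := by
  induction j with
  | zero =>
    ext z
    simp [circleRotation, circleCover]
  | succ j ih =>
    rw [pow_succ, ih]
    ext z
    change ((circleCover (j * t) * (circleCover t * z) : Circle) : ℂ) =
      ((circleCover ((j + 1 : ℕ) * t) * z : Circle) : ℂ)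
    rw [← mul_assoc, ← circleCover_add]
    push_cast
    rw [add_mul, one_mul]

theorem circleRotation_eq_one_iff {t : ℝ} : circleRotation t = 1 ↔ ∃ m : ℤ, t = m := by
  have h0 : circleCover 0 = 1 := by simp [circleCover]
  have : circleCover t = circleCover 0 ↔ ∃ m : ℤ, t = m := by simp [circleCover_eq_iff]
  rw [← this, h0]
  constructor
  · intro h
    have e : circleCover t * 1 = 1 :=
      congrArg (fun f : AnalyticDiff => (f : Circle ≃ₜ Circle) 1) h
    simpa using e
  · intro h
    ext z
    change ((circleCover t * z : Circle) : ℂ) = z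
    rw [h, one_mul]

theorem orderOf_circleRotation {n : ℕ} (hn : n ≠ 0) :
    orderOf (circleRotation (1 / (n : ℝ))) = n := by
  have hn' : (n : ℝ) ≠ 0 := by exact_mod_cast hn
  refine Nat.dvd_antisymm (orderOf_dvd_of_pow_eq_one ?_) ?_
  · rw [circleRotation_pow, circleRotation_eq_one_iff]
    exact ⟨1, by field_simp; simp⟩
  · have := pow_orderOf_eq_one (circleRotation (1 / (n : ℝ)))
    rw [circleRotation_pow, circleRotation_eq_one_iff] at this
    obtain ⟨m, hm⟩ := this
    field_simp at hm
    have hm' : (orderOf (circleRotation (1 / (n : ℝ))) : ℤ) = n * m := by exact_mod_cast hm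
    exact Int.natCast_dvd_natCast.1 ⟨m, hm'⟩

/-- A lift of the rotation by `t` is the translation by a real number congruent to `t`. -/
theorem exists_lift_circleRotation {t : ℝ} {F : LiftedAnalyticDiff}
    (hF : universalCoverExtension.rightHom F = circleRotation t) :
    ∃ m : ℤ, ∀ x, F.1.2 x = x + (t + m) := by
  obtain ⟨⟨f, F⟩, hp⟩ := F
  obtain rfl : f = circleRotation t := hF
  have hp' : ∀ x, circleCover (F x) = circleCover (x + t) := fun x => by
    rw [add_comm, circleCover_add]
    exact hp x
  obtain ⟨m, hm⟩ : ∃ m : ℤ, ∀ x, F x - (x + t) = m := by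
    refine exists_int_eq_of_continuous ((CircleDeg1Lift.toOrderIso F).continuous.sub
      (by fun_prop)) fun x => ?_
    obtain ⟨m, hm⟩ := circleCover_eq_iff.1 (hp' x)
    exact ⟨m, by linarith⟩
  exact ⟨m, fun x => by change F x = _; linarith [hm x]⟩

/-- The chosen lifts of rotations are translations, so `f(g, r) = a(g) + a(r) - a(gr)` with real
translation lengths `a`. Summing over the group cancels the first and last terms and leaves `n
a(r)`, where `a(r) = 1/n + m`. -/
theorem sum_sectionCocycle_rotation {n : ℕ} (hn : n ≠ 0) {r : AnalyticDiff}
    (hr : r = circleRotation (1 / (n : ℝ))) [Fintype (Subgroup.zpowers r)]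
    (σ : universalCoverExtension.Section) :
    ∃ m : ℤ, ∑ g : Subgroup.zpowers r,
      universalCoverExtension.sectionCocycle σ ((g : AnalyticDiff), r) = 1 + n * m := by
  have hn' : (n : ℝ) ≠ 0 := by exact_mod_cast hn
  have hord : orderOf r = n := by rw [hr, orderOf_circleRotation hn]
  have hfin : IsOfFinOrder r := by
    rw [← orderOf_pos_iff, hord]
    omega
  have hcard : Fintype.card (Subgroup.zpowers r) = n := by
    rw [Fintype.card_eq_nat_card, Nat.card_zpowers, hord]
  obtain ⟨m, hm⟩ := exists_lift_circleRotation
    (show universalCoverExtension.rightHom (σ r) = _ from (σ.rightHom_section r).trans hr)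
  have ht : ∀ g : Subgroup.zpowers r, ∀ x, (σ g).1.2 x = x + (σ g).1.2 0 := by
    rintro ⟨g, hg⟩ x
    obtain ⟨j, rfl⟩ := hfin.mem_powers_iff_mem_zpowers.2 hg
    obtain ⟨l, hl⟩ := exists_lift_circleRotation
      (show universalCoverExtension.rightHom (σ (r ^ j)) = circleRotation (j * (1 / n)) by
        rw [σ.rightHom_section, hr, circleRotation_pow])
    change (σ (r ^ j)).1.2 x = x + (σ (r ^ j)).1.2 0
    rw [hl, hl 0, zero_add]
  have hc : ∀ g : Subgroup.zpowers r,
      (universalCoverExtension.sectionCocycle σ ((g : AnalyticDiff), r) : ℝ) =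
        (σ g).1.2 0 + (1 / n + m) - (σ (g * ⟨r, Subgroup.mem_zpowers r⟩ :
          Subgroup.zpowers r)).1.2 0 := by
    intro g
    -- The defining relation of the cocycle, evaluated at the point `0` of `ℝ`.
    have e : (universalCoverExtension.sectionCocycle σ ((g : AnalyticDiff), r) : ℝ) +
        (σ (g * r)).1.2 0 = (σ g).1.2 ((σ r).1.2 0) :=
      congrArg (fun F : LiftedAnalyticDiff => F.1.2 (0 : ℝ))
        (universalCoverExtension.inl_sectionCocycle σ g r)
    rw [ht g, hm 0] at e
    change _ = _ - (σ (g * r)).1.2 0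
    linarith
  refine ⟨m, ?_⟩
  have : ((∑ g : Subgroup.zpowers r,
      universalCoverExtension.sectionCocycle σ ((g : AnalyticDiff), r) : ℤ) : ℝ) =
        ((1 + n * m : ℤ) : ℝ) := by
    push_cast
    simp only [hc, Finset.sum_sub_distrib, Finset.sum_add_distrib]
    -- Right multiplication by `r` permutes the subgroup, so the sums of `a(g)` and of `a(gr)`
    -- agree.
    have hs := Equiv.sum_comp (Equiv.mulRight (⟨r, Subgroup.mem_zpowers r⟩ : Subgroup.zpowers r))
      (fun g : Subgroup.zpowers r => (σ g).1.2 (0 : ℝ))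
    simp only [Equiv.coe_mulRight] at hs
    rw [hs, Finset.sum_const, Finset.sum_const, Finset.card_univ, hcard]
    simp only [nsmul_eq_mul]
    field_simp
    ring
  exact Int.cast_injective this

end Rotation

/-- `G = Diff^ω_+ S¹` is `AnalyticDiff`; since `G` is discrete, the (co)homology of `BG` is the
group (co)homology of `G` with trivial coefficients. -/
theorem corollary1p16 (n : ℕ) (hn : 2 ≤ n) (k : ℕ) (hk : 1 ≤ k)
    (h : homologyInclusion (Subgroup.zpowers (circleRotation (1 / (n : ℝ)))) (2 * k - 1) = 0) :
    cupPow rationalEulerClass k ≠ 0 := by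
  intro h0
  obtain ⟨k, rfl⟩ : ∃ m, k = m + 1 := ⟨k - 1, by omega⟩
  have hord := orderOf_circleRotation (show n ≠ 0 by omega)
  have : Finite (Subgroup.zpowers (circleRotation (1 / (n : ℝ)))) :=
    Nat.finite_of_card_ne_zero (by rw [Nat.card_zpowers, hord]; omega)
  have := Fintype.ofFinite (Subgroup.zpowers (circleRotation (1 / (n : ℝ))))
  -- After the substitution the degree `2 * (k + 1) - 1` in `h` reduces definitionally to `2 * k +
  -- 1`, and unfolding the Euler class supplies the cocycle.
  have hdvd := card_dvd_sum_pow ⟨_, Subgroup.mem_zpowers (circleRotation (1 / (n : ℝ)))⟩ k h _ h0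
  obtain ⟨m, hm⟩ := sum_sectionCocycle_rotation (n := n) (by omega) rfl
    ⟨Function.surjInv universalCoverExtension.rightHom_surjective,
      Function.rightInverse_surjInv universalCoverExtension.rightHom_surjective⟩
  rw [Fintype.card_eq_nat_card, Nat.card_zpowers, hord] at hdvd
  have hdvd' : (n : ℤ) ∣ (1 + n * m) ^ (k + 1) := hm ▸ hdvd
  -- Since `n` is coprime to `1 + n m` but divides a power of it, `n` would be a unit of `ℤ`.
  have hco : IsCoprime (n : ℤ) (1 + n * m) := ⟨-m, 1, by ring⟩
  have := Int.isUnit_iff.1 (hco.pow_right.isUnit_of_dvd' dvd_rfl hdvd')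
  omega
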